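/- **Theorem (Elimination of outer subaisle double edges).** A rectangular warehouse consists of finitely many vertical aisles and at least two horizontal cross-aisles. The distance between two neighbouring aisles is positive and is the same along every cross-aisle. The part of an aisle between two consecutive cross-aisles is called a subaisle, and the strip between two consecutive cross-aisles a block; the subaisles of one block all have the same positive length. Each subaisle contains finitely many (possibly no) pick locations, all in its interior. There is one depot, which also counts as a pick location and lies either at an intersection of an aisle and a cross-aisle or at one of the pick locations inside the subaisles. Let $G$ be the graph whose vertices are the intersections and the pick locations and whose edges are the pieces of aisles and cross-aisles joining consecutive vertices, each with its length. A *tour subgraph* $T$ of $G$ is an assignment of multiplicities in $\{0,1,2,\dots\}$ to the edges of $G$ for which there is a closed walk from the depot that visits all pick locations and traverses each edge exactly as often as its multiplicity in $T$. The length of $T$ is the sum of the lengths of its edges, counted with multiplicity. A *double edge* of $T$ is a stretch of an aisle consisting of one or more consecutive full subaisles such that every edge of $G$ in the stretch has multiplicity $2$ in $T$ and no horizontal edge of $T$ is incident to an intersection strictly between the two ends of the stretch. An aisle is *non-empty* if it contains at least one pick location (the depot included). In every rectangular warehouse with at least two non-empty aisles, with any number of blocks, there is a tour subgraph $T$ of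 minimum length such that no double edge of $T$ includes a subaisle of the uppermost or of the lowermost block. -/

import Mathlib

/-- A rectangular grid of `m + 1` vertical aisles crossed by `n + 2` horizontal cross-aisles,
hence with `n + 1` blocks.  Aisles are numbered from left to right, cross-aisles and blocks
from top to bottom; block `k` lies between cross-aisles `k` and `k + 1`, and gap `g` lies between
aisles `g` and `g + 1`.  The subaisle of aisle `i` in block `k` holds `numPicks i k` pick locations
strictly between its two ends; they cut it into `numPicks i k + 1` segments, listed from top to
bottom with their lengths. -/
structure Layout (m n : ℕ) where
  /-- distance between two neighbouring aisles, the same along every cross-aisle -/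
  spacing : Fin m → ℝ
  /-- length of the subaisles of a block, the same in every aisle -/
  height : Fin (n + 1) → ℝ
  numPicks : Fin (m + 1) → Fin (n + 1) → ℕ
  segLength : ∀ i k, Fin (numPicks i k + 1) → ℝ
  spacing_pos : ∀ g, 0 < spacing g
  segLength_pos : ∀ i k j, 0 < segLength i k j
  sum_segLength : ∀ i k, ∑ j, segLength i k j = height k

namespace Layout

variable {m n : ℕ}

/-- Vertices of the warehouse graph: the intersections of aisles and cross-aisles, and the pick
locations inside the subaisles. -/
inductive Vertex (L : Layout m n) : Type
  | node (i : Fin (m + 1)) (c : Fin (n + 2)) : Vertex L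
  | pick (i : Fin (m + 1)) (k : Fin (n + 1)) (j : Fin (L.numPicks i k)) : Vertex L
  deriving DecidableEq

/-- Edges of the warehouse graph: `horiz g c` is the piece of cross-aisle `c` over gap `g`, and
`vert i k j` is the `j`-th segment of the subaisle of aisle `i` in block `k`. -/
inductive Edge (L : Layout m n) : Type
  | horiz (g : Fin m) (c : Fin (n + 2)) : Edge L
  | vert (i : Fin (m + 1)) (k : Fin (n + 1)) (j : Fin (L.numPicks i k + 1)) : Edge L
  deriving DecidableEq

/-- The vertices along a subaisle from top to bottom: the upper intersection, the pick locations,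
the lower intersection. -/
def site (L : Layout m n) (i : Fin (m + 1)) (k : Fin (n + 1)) :
    Fin (L.numPicks i k + 2) → L.Vertex :=
  Fin.cons (α := fun _ => L.Vertex) (Vertex.node i k.castSucc)
    (Fin.snoc (α := fun _ => L.Vertex) (fun j => Vertex.pick i k j) (Vertex.node i k.succ))

/-- The left or upper end of an edge. -/
def Edge.fst {L : Layout m n} : L.Edge → L.Vertex
  | .horiz g c => .node g.castSucc c
  | .vert i k j => L.site i k j.castSucc

/-- The right or lower end of an edge. -/
def Edge.snd {L : Layout m n} : L.Edge → L.Vertex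
  | .horiz g c => .node g.succ c
  | .vert i k j => L.site i k j.succ

/-- The edge `e` joins `u` and `v`. -/
def Edge.Joins {L : Layout m n} (e : L.Edge) (u v : L.Vertex) : Prop :=
  (e.fst = u ∧ e.snd = v) ∨ (e.fst = v ∧ e.snd = u)

/-- Walks in the warehouse graph; vertices and edges may be repeated. -/
inductive Route (L : Layout m n) : L.Vertex → L.Vertex → Type
  | nil (v : L.Vertex) : Route L v v
  | cons {u v w : L.Vertex} (e : L.Edge) (h : e.Joins u v) (p : Route L v w) : Route L u w

/-- The edges traversed by a walk, with repetitions. -/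
def Route.edges {L : Layout m n} {u v : L.Vertex} : L.Route u v → List L.Edge
  | .nil _ => []
  | .cons e _ p => e :: p.edges

/-- The vertices visited by a walk, with repetitions. -/
def Route.support {L : Layout m n} {u v : L.Vertex} : L.Route u v → List L.Vertex
  | .nil v => [v]
  | .cons (u := u) _ _ p => u :: p.support

/-- Total length of the multigraph that contains each edge `e` with multiplicity `T e`. -/
noncomputable def totalLength (L : Layout m n) (T : L.Edge → ℕ) : ℝ :=
  (∑ g, ∑ c, (T (.horiz g c) : ℝ) * L.spacing g) +
    ∑ i, ∑ k, ∑ j, (T (.vert i k j) : ℝ) * L.segLength i k j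

/-- `T` has a double edge in aisle `i` from cross-aisle `a` down to cross-aisle `b`: it spans one or
more subaisles, each of them is traversed twice along its whole length, and no horizontal edge of
`T` is incident to an intersection of the aisle strictly between the two ends. -/
def IsDoubleEdge (L : Layout m n) (T : L.Edge → ℕ) (i : Fin (m + 1)) (a b : Fin (n + 2)) : Prop :=
  a < b ∧
  (∀ k : Fin (n + 1), a ≤ k.castSucc → k.succ ≤ b → ∀ j, T (.vert i k j) = 2) ∧
  (∀ c, a < c → c < b → ∀ g : Fin m, g.castSucc = i ∨ g.succ = i → T (.horiz g c) = 0)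

/-- The stretch of an aisle between the cross-aisles `a < b` includes the subaisle of the first
(upper) or the last (lower) block. -/
def IncludesOuter (a b : Fin (n + 2)) : Prop := a = 0 ∨ b = Fin.last (n + 1)

end Layout

/-- A rectangular warehouse: a layout with a depot, which may be an intersection and is otherwise
one of the pick locations in the subaisles. -/
structure Warehouse (m n : ℕ) extends Layout m n where
  depot : toLayout.Vertex

namespace Warehouse

variable {m n : ℕ}

/-- The locations that have to be visited: all pick locations in the subaisles, and the depot. -/
def Required (W : Warehouse m n) (v : W.Vertex) : Prop :=
  v = W.depot ∨ ∃ i k j, v = .pick i k j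

/-- The aisle that contains a vertex. -/
def aisleOf (W : Warehouse m n) : W.Vertex → Fin (m + 1)
  | .node i _ => i
  | .pick i _ _ => i

/-- An aisle is non-empty if it contains a location that has to be visited. -/
def AisleNonempty (W : Warehouse m n) (i : Fin (m + 1)) : Prop :=
  ∃ v, W.Required v ∧ W.aisleOf v = i

/-- `T` (edges with multiplicities) is a tour subgraph: some closed walk from the depot visits all
required locations and traverses each edge `e` exactly `T e` times. -/
def IsTourSubgraph (W : Warehouse m n) (T : W.Edge → ℕ) : Prop :=
  ∃ p : W.Route W.depot W.depot,
    (∀ v, W.Required v → v ∈ p.support) ∧ ∀ e, T e = p.edges.count e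

/-- `T` is a tour subgraph of minimum length. -/
def IsMinTourSubgraph (W : Warehouse m n) (T : W.Edge → ℕ) : Prop :=
  W.IsTourSubgraph T ∧ ∀ T', W.IsTourSubgraph T' → W.totalLength T ≤ W.totalLength T'

end Warehouse

/-!
Counting degrees modulo two, Euler's theorem describes tour subgraphs as connected multigraphs
without boundary that reach all required locations.

Among the minimum tour subgraphs take one, `T`, with as few doubled outer subaisles as possible, and
suppose that it doubles aisle `i` from cross-aisle `0` down to cross-aisle `b`.  If moreover `T` has
a horizontal edge from aisle `i` to a neighbouring aisle at cross-aisle `0` or `b`, then one copy of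
the stretch can be moved to the neighbouring aisle and one copy of the horizontal edge to the other
one of the two cross-aisles.  The length does not change.  The result is again a tour subgraph: it
arises from `T` by adding the rectangle formed by the four pieces and dropping two copies of two of
its sides, where only the horizontal one may disappear, and an edge of a cycle can be spared.  By
the choice of `T` the neighbouring aisle must now have a doubled subaisle in the upper block.

Let `b = 1`.  A horizontal edge at the top of aisle `i` has multiplicity one, as otherwise the
rectangle would still be present after the move and could be used to drop a doubled edge.  So by
parity there are none or two, one on each side, and the move of one of them leaves a dead end at the
top of the neighbouring aisle.  A dead end that need not be visited can be removed, so the depot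
would have to be at the top of both neighbouring aisles.  Hence there are none, and the depot is at
the top of aisle `i` itself.  As some required location lies in another aisle, `T` has a horizontal
edge at a cross-aisle `b` further down to which aisle `i` is doubled, and moving this edge up to
cross-aisle `0` yields a contradiction.  The lowest block is treated by turning the warehouse upside
down.
-/

namespace Layout

variable {m n : ℕ} {L : Layout m n}

/-! ### Edges and their ends -/

theorem Edge.Joins.symm {e : L.Edge} {u v : L.Vertex} (h : e.Joins u v) : e.Joins v u := Or.symm h

theorem Edge.joins_fst_snd (e : L.Edge) : e.Joins e.fst e.snd := Or.inl ⟨rfl, rfl⟩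

theorem Edge.joins_iff_mk_eq {e : L.Edge} {u v : L.Vertex} :
    e.Joins u v ↔ s(e.fst, e.snd) = s(u, v) := Sym2.eq_iff.symm

theorem Edge.fst_vert_zero (i : Fin (m + 1)) (k : Fin (n + 1)) :
    (vert (L := L) i k 0).fst = .node i k.castSucc := rfl

theorem Edge.fst_vert_succ (i : Fin (m + 1)) (k : Fin (n + 1)) (j : Fin (L.numPicks i k)) :
    (vert i k j.succ).fst = .pick i k j := by
  simp [fst, site]

theorem Edge.snd_vert_castSucc (i : Fin (m + 1)) (k : Fin (n + 1)) (j : Fin (L.numPicks i k)) :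
    (vert i k j.castSucc).snd = .pick i k j := by
  simp [snd, site]

theorem Edge.snd_vert_last (i : Fin (m + 1)) (k : Fin (n + 1)) :
    (vert (L := L) i k (Fin.last _)).snd = .node i k.succ := by
  simp [snd, site]

theorem site_injective (i : Fin (m + 1)) (k : Fin (n + 1)) : Function.Injective (L.site i k) := by
  refine Fin.cons_injective_iff.2 ⟨?_, Fin.snoc_injective_iff.2 ⟨?_, ?_⟩⟩
  · rintro ⟨j, hj⟩
    cases j using Fin.lastCases <;> simp [k.castSucc_lt_succ.ne'] at hj
  · exact fun j j' h => by simpa using h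
  · simp

theorem Edge.fst_ne_snd (e : L.Edge) : e.fst ≠ e.snd := by
  cases e with
  | horiz g c => simp [fst, snd, g.castSucc_lt_succ.ne]
  | vert i k j => exact (site_injective i k).ne j.castSucc_lt_succ.ne

theorem Edge.Joins.ne {e : L.Edge} {u v : L.Vertex} (h : e.Joins u v) : u ≠ v := by
  rcases h with ⟨rfl, rfl⟩ | ⟨rfl, rfl⟩
  · exact e.fst_ne_snd
  · exact e.fst_ne_snd.symm

theorem Edge.Joins.eq_of_pick {e : L.Edge} {i : Fin (m + 1)} {k : Fin (n + 1)}
    {j : Fin (L.numPicks i k)} {v : L.Vertex} (h : e.Joins (.pick i k j) v) :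
    e = .vert i k j.castSucc ∨ e = .vert i k j.succ := by
  cases e with
  | horiz g c => simp [Joins, fst, snd] at h
  | vert i' k' j' =>
    rcases h with ⟨h, -⟩ | ⟨-, h⟩
    · right
      cases j' using Fin.cases with
      | zero => simp [fst_vert_zero] at h
      | succ j' =>
        rw [fst_vert_succ] at h
        cases h
        rfl
    · left
      cases j' using Fin.lastCases with
      | last => simp [snd_vert_last] at h
      | cast j' =>
        rw [snd_vert_castSucc] at h
        cases h
        rfl

/-- Gap `g` lies between the neighbouring aisles `i` and `i'`, in either order. -/
def Separates (g : Fin m) (i i' : Fin (m + 1)) : Prop :=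
  g.castSucc = i ∧ g.succ = i' ∨ g.castSucc = i' ∧ g.succ = i

theorem Separates.symm {g : Fin m} {i i' : Fin (m + 1)} (h : Separates g i i') :
    Separates g i' i := Or.symm h

theorem Separates.ne {g : Fin m} {i i' : Fin (m + 1)} (h : Separates g i i') : i ≠ i' := by
  rcases h with ⟨rfl, rfl⟩ | ⟨rfl, rfl⟩
  · exact g.castSucc_lt_succ.ne
  · exact g.castSucc_lt_succ.ne'

theorem Separates.joins {g : Fin m} {i i' : Fin (m + 1)} (h : Separates g i i')
    (c : Fin (n + 2)) : (Edge.horiz (L := L) g c).Joins (.node i c) (.node i' c) := by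
  rcases h with ⟨rfl, rfl⟩ | ⟨rfl, rfl⟩
  · exact Or.inl ⟨rfl, rfl⟩
  · exact Or.inr ⟨rfl, rfl⟩

theorem Edge.Joins.eq_of_node {e : L.Edge} {i : Fin (m + 1)} {c : Fin (n + 2)} {v : L.Vertex}
    (h : e.Joins (.node i c) v) :
    (∃ g i', Separates g i i' ∧ e = .horiz g c) ∨ (∃ k, k.castSucc = c ∧ e = .vert i k 0) ∨
      ∃ k, k.succ = c ∧ e = .vert i k (Fin.last _) := by
  cases e with
  | horiz g c' =>
    left
    rcases h with ⟨h, -⟩ | ⟨-, h⟩ <;> cases h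
    · exact ⟨g, g.succ, .inl ⟨rfl, rfl⟩, rfl⟩
    · exact ⟨g, g.castSucc, .inr ⟨rfl, rfl⟩, rfl⟩
  | vert i' k j =>
    right
    rcases h with ⟨h, -⟩ | ⟨-, h⟩
    · left
      cases j using Fin.cases with
      | zero => cases h; exact ⟨k, rfl, rfl⟩
      | succ j => simp [fst_vert_succ] at h
    · right
      cases j using Fin.lastCases with
      | last =>
        rw [snd_vert_last] at h
        cases h
        exact ⟨k, rfl, rfl⟩
      | cast j => simp [snd_vert_castSucc] at h

/-- A vertex is an intersection, given by aisle and cross-aisle, or a pick location, given by aisle,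
block and position. -/
def vertexEquiv (L : Layout m n) :
    L.Vertex ≃ (Fin (m + 1) × Fin (n + 2)) ⊕
      (Σ i : Fin (m + 1), Σ k : Fin (n + 1), Fin (L.numPicks i k)) where
  toFun
    | .node i c => .inl (i, c)
    | .pick i k j => .inr ⟨i, k, j⟩
  invFun
    | .inl x => .node x.1 x.2
    | .inr x => .pick x.1 x.2.1 x.2.2
  left_inv v := by cases v <;> rfl
  right_inv x := by rcases x with ⟨_, _⟩ | ⟨_, _, _⟩ <;> rfl

/-- An edge is horizontal, given by gap and cross-aisle, or vertical, given by aisle, block and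
position. -/
def edgeEquiv (L : Layout m n) :
    L.Edge ≃ (Fin m × Fin (n + 2)) ⊕
      (Σ i : Fin (m + 1), Σ k : Fin (n + 1), Fin (L.numPicks i k + 1)) where
  toFun
    | .horiz g c => .inl (g, c)
    | .vert i k j => .inr ⟨i, k, j⟩
  invFun
    | .inl x => .horiz x.1 x.2
    | .inr x => .vert x.1 x.2.1 x.2.2
  left_inv e := by cases e <;> rfl
  right_inv x := by rcases x with ⟨_, _⟩ | ⟨_, _, _⟩ <;> rfl

instance : Fintype L.Edge := Fintype.ofEquiv _ L.edgeEquiv.symm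

theorem sum_edge {M : Type*} [AddCommMonoid M] (f : L.Edge → M) :
    ∑ e, f e = (∑ g, ∑ c, f (.horiz g c)) + ∑ i, ∑ k, ∑ j, f (.vert i k j) := by
  rw [← Equiv.sum_comp L.edgeEquiv.symm f, Fintype.sum_sum_type, Fintype.sum_prod_type,
    Fintype.sum_sigma]
  simp only [Fintype.sum_sigma]
  rfl

/-- The length of an edge. -/
def Edge.length : L.Edge → ℝ
  | .horiz g _ => L.spacing g
  | .vert i k j => L.segLength i k j

theorem Edge.length_pos (e : L.Edge) : 0 < e.length := by
  cases e with
  | horiz g c => exact L.spacing_pos g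
  | vert i k j => exact L.segLength_pos i k j

theorem single_le {T : L.Edge → ℕ} {e : L.Edge} (he : 0 < T e) : Pi.single e 1 ≤ T := by
  intro f
  rcases eq_or_ne f e with rfl | hf
  · rwa [Pi.single_eq_same]
  · simp [hf]

theorem totalLength_eq_sum (T : L.Edge → ℕ) : L.totalLength T = ∑ e, (T e : ℝ) * e.length := by
  rw [sum_edge]; rfl

theorem totalLength_add (S T : L.Edge → ℕ) :
    L.totalLength (S + T) = L.totalLength S + L.totalLength T := by
  simp [totalLength_eq_sum, add_mul, Finset.sum_add_distrib]

theorem totalLength_single (e : L.Edge) : L.totalLength (Pi.single e 1) = e.length := by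
  simp [totalLength_eq_sum, Pi.single_apply]

theorem totalLength_strictMono : StrictMono L.totalLength := by
  intro S T h
  obtain ⟨hle, e, he⟩ := Pi.lt_def.1 h
  rw [totalLength_eq_sum, totalLength_eq_sum]
  exact Finset.sum_lt_sum
    (fun f _ => mul_le_mul_of_nonneg_right (mod_cast hle f) f.length_pos.le)
    ⟨e, Finset.mem_univ _, mul_lt_mul_of_pos_right (mod_cast he) e.length_pos⟩

/-! ### Degrees modulo two -/

/-- The boundary modulo two of an edge: the sum of its two ends. -/
def Edge.boundary (e : L.Edge) : L.Vertex → ZMod 2 := Pi.single e.fst 1 + Pi.single e.snd 1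

/-- The boundary modulo two of a multigraph.  Its value at a vertex is the parity of the degree, so
all degrees are even precisely when it vanishes. -/
def boundary (T : L.Edge → ℕ) : L.Vertex → ZMod 2 := ∑ e, T e • e.boundary

theorem Edge.Joins.boundary_eq {e : L.Edge} {u v : L.Vertex} (h : e.Joins u v) :
    e.boundary = Pi.single u 1 + Pi.single v 1 := by
  rcases h with ⟨rfl, rfl⟩ | ⟨rfl, rfl⟩
  · rfl
  · exact add_comm _ _

theorem boundary_zero : boundary (0 : L.Edge → ℕ) = 0 := by simp [boundary]

theorem boundary_add (S T : L.Edge → ℕ) : boundary (S + T) = boundary S + boundary T := by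
  simp [boundary, add_smul, Finset.sum_add_distrib]

theorem boundary_single (e : L.Edge) : boundary (Pi.single e 1) = e.boundary := by
  simp [boundary, Pi.single_apply, ite_smul]

theorem Edge.exists_joins_of_boundary_ne_zero {e : L.Edge} {u : L.Vertex} (h : e.boundary u ≠ 0) :
    ∃ v, e.Joins u v := by
  by_cases hu : e.fst = u
  · exact ⟨e.snd, Or.inl ⟨hu, rfl⟩⟩
  · by_cases hv : e.snd = u
    · exact ⟨e.fst, Or.inr ⟨rfl, hv⟩⟩
    · simp [boundary, Ne.symm hu, Ne.symm hv] at h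

theorem boundary_congr {S T : L.Edge → ℕ} (h : ∀ e, S e ≡ T e [MOD 2]) :
    boundary S = boundary T := by
  refine Finset.sum_congr rfl fun e _ => ?_
  rw [← Nat.cast_smul_eq_nsmul (ZMod 2), ← Nat.cast_smul_eq_nsmul (ZMod 2),
    (ZMod.natCast_eq_natCast_iff _ _ _).2 (h e)]

theorem exists_joins_of_boundary_ne_zero {T : L.Edge → ℕ} {u : L.Vertex} (h : boundary T u ≠ 0) :
    ∃ e v, 0 < T e ∧ e.Joins u v := by
  rw [boundary, Finset.sum_apply] at h
  obtain ⟨e, -, he⟩ := Finset.exists_ne_zero_of_sum_ne_zero h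
  obtain ⟨v, hj⟩ := e.exists_joins_of_boundary_ne_zero (u := u) fun h0 => he (by simp [h0])
  exact ⟨e, v, Nat.pos_of_ne_zero fun h0 => he (by simp [h0]), hj⟩

theorem even_add_of_boundary_eq_zero {T : L.Edge → ℕ} {u v w : L.Vertex} {e f : L.Edge}
    (hT : boundary T u = 0) (hef : e ≠ f) (he : e.Joins u v) (hf : f.Joins u w)
    (hstar : ∀ a x, 0 < T a → a.Joins u x → a = e ∨ a = f) : Even (T e + T f) := by
  have hsum : boundary T u = T e + T f := by
    rw [boundary, Finset.sum_apply, Finset.sum_eq_add e f hef]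
    · simp [he.boundary_eq, hf.boundary_eq, he.ne, hf.ne]
    · rintro a - ⟨hae, haf⟩
      by_contra hne
      obtain ⟨x, hx⟩ := a.exists_joins_of_boundary_ne_zero (u := u) fun h0 => hne (by simp [h0])
      have ha : 0 < T a := Nat.pos_of_ne_zero fun h0 => hne (by simp [h0])
      exact (hstar a x ha hx).elim hae haf
    · simp
    · simp
  rw [hsum] at hT
  exact ZMod.natCast_eq_zero_iff_even.1 (mod_cast hT)

/-! ### Connectedness and Euler's theorem -/

/-- Reachability along edges of positive multiplicity. -/
def Conn (T : L.Edge → ℕ) : L.Vertex → L.Vertex → Prop :=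
  Relation.ReflTransGen fun u v => ∃ e : L.Edge, 0 < T e ∧ e.Joins u v

namespace Conn

variable {S T : L.Edge → ℕ} {u v w : L.Vertex}

theorem refl (T : L.Edge → ℕ) (v : L.Vertex) : Conn T v v := Relation.ReflTransGen.refl

theorem trans (h : Conn T u v) (h' : Conn T v w) : Conn T u w := Relation.ReflTransGen.trans h h'

theorem of_joins {e : L.Edge} (he : 0 < T e) (h : e.Joins u v) : Conn T u v :=
  Relation.ReflTransGen.single ⟨e, he, h⟩

theorem symm (h : Conn T u v) : Conn T v u :=
  have : Std.Symm fun u v : L.Vertex => ∃ e : L.Edge, 0 < T e ∧ e.Joins u v :=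
    ⟨fun _ _ ⟨e, he, hj⟩ => ⟨e, he, hj.symm⟩⟩
  Relation.ReflTransGen.stdSymm.symm _ _ h

theorem of_invariant {P : L.Vertex → Prop} (h : Conn T u v) (hu : P u)
    (step : ∀ e a b, 0 < T e → e.Joins a b → P a → P b) : P v := by
  induction h with
  | refl => exact hu
  | tail _ hs ih =>
    obtain ⟨e, he, hj⟩ := hs
    exact step e _ _ he hj ih

theorem map (f : L.Vertex → L.Vertex) (h : ∀ e, 0 < S e → Conn T (f e.fst) (f e.snd))
    (huv : Conn S u v) : Conn T (f u) (f v) := by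
  refine huv.of_invariant (P := fun v => Conn T (f u) (f v)) (refl _ _)
    fun e a b he hj hua => hua.trans ?_
  rcases hj with ⟨rfl, rfl⟩ | ⟨rfl, rfl⟩
  · exact h e he
  · exact (h e he).symm

theorem mono (h : ∀ e, 0 < S e → 0 < T e) (huv : Conn S u v) : Conn T u v :=
  huv.map id fun e he => of_joins (h e he) e.joins_fst_snd

end Conn

namespace Route

variable {u v w : L.Vertex}

/-- The multiplicities of the edges in a walk. -/
def mult (p : L.Route u v) (e : L.Edge) : ℕ := p.edges.count e

theorem mult_nil (u : L.Vertex) : (nil u : L.Route u u).mult = 0 := by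
  ext; simp [mult, edges]

theorem mult_cons (e : L.Edge) (h : e.Joins u v) (p : L.Route v w) :
    (cons e h p).mult = Pi.single e 1 + p.mult := by
  ext f
  rw [Pi.add_apply, Pi.single_apply, add_comm]
  simp only [mult, edges, List.count_cons, beq_iff_eq, eq_comm (a := f)]

theorem mult_pos {p : L.Route u v} {e : L.Edge} : 0 < p.mult e ↔ e ∈ p.edges :=
  List.count_pos_iff

theorem boundary_mult (p : L.Route u v) : boundary p.mult = Pi.single u 1 + Pi.single v 1 := by
  induction p with
  | nil u => rw [mult_nil, boundary_zero, ZModModule.add_self]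
  | cons e h p ih =>
    rw [mult_cons, boundary_add, boundary_single, ih, h.boundary_eq, ZModModule.add_add_add_cancel]

theorem boundary_mult_closed (p : L.Route u u) : boundary p.mult = 0 := by
  rw [boundary_mult, ZModModule.add_self]

/-- Concatenation of walks. -/
def append {u v w : L.Vertex} : L.Route u v → L.Route v w → L.Route u w
  | nil _, q => q
  | cons e h p, q => cons e h (append p q)

theorem mult_append (p : L.Route u v) (q : L.Route v w) :
    (p.append q).mult = p.mult + q.mult := by
  induction p with
  | nil u => rw [append, mult_nil, zero_add]
  | cons e h p ih => rw [append, mult_cons, mult_cons, ih, add_assoc]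

/-- The reversed walk. -/
def reverse {u v : L.Vertex} : L.Route u v → L.Route v u
  | nil u => nil u
  | cons e h p => p.reverse.append (cons e h.symm (nil _))

theorem mult_reverse (p : L.Route u v) : p.reverse.mult = p.mult := by
  induction p with
  | nil u => rfl
  | cons e h p ih =>
    rw [reverse, mult_append, mult_cons, mult_cons, mult_nil, ih, add_zero, add_comm]

theorem start_mem_support (p : L.Route u v) : u ∈ p.support := by
  cases p <;> simp [support]

theorem mem_support_of_joins {p : L.Route u v} {e : L.Edge} {a b : L.Vertex} (he : e ∈ p.edges)
    (h : e.Joins a b) : b ∈ p.support := by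
  induction p with
  | nil u => simp [edges] at he
  | cons f hf p ih =>
    rcases List.mem_cons.1 he with rfl | he
    · have hstart := p.start_mem_support
      rcases hf with ⟨rfl, rfl⟩ | ⟨rfl, rfl⟩ <;> rcases h with ⟨rfl, rfl⟩ | ⟨rfl, rfl⟩ <;>
        simp [support, hstart]
    · exact List.mem_cons_of_mem _ (ih he)

theorem exists_split_of_mem_support (p : L.Route u v) (hw : w ∈ p.support) :
    ∃ (q : L.Route u w) (r : L.Route w v), p.mult = q.mult + r.mult := by
  induction p with
  | nil u =>
    obtain rfl : w = u := List.mem_singleton.1 hw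
    exact ⟨nil w, nil w, by rw [mult_nil, add_zero]⟩
  | cons e h p ih =>
    rcases List.mem_cons.1 hw with rfl | hw
    · exact ⟨nil w, cons e h p, by rw [mult_nil, zero_add]⟩
    · obtain ⟨q, r, hqr⟩ := ih hw
      exact ⟨cons e h q, r, by rw [mult_cons, mult_cons, hqr, add_assoc]⟩

theorem exists_split_of_mem_edges (p : L.Route u v) {e : L.Edge} (he : e ∈ p.edges) :
    ∃ (a b : L.Vertex) (q : L.Route u a) (r : L.Route b v), e.Joins a b ∧
      p.mult = q.mult + Pi.single e 1 + r.mult := by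
  induction p with
  | nil u => simp [edges] at he
  | cons f h p ih =>
    rcases List.mem_cons.1 he with rfl | he
    · exact ⟨_, _, nil _, p, h, by rw [mult_cons, mult_nil, zero_add]⟩
    · obtain ⟨a, b, q, r, hj, hqr⟩ := ih he
      exact ⟨a, b, cons f h q, r, hj, by rw [mult_cons, mult_cons, hqr]; simp only [add_assoc]⟩

theorem conn (p : L.Route u v) : Conn p.mult u v := by
  induction p with
  | nil u => exact Conn.refl _ _
  | cons e h p ih =>
    rw [mult_cons]
    exact (Conn.of_joins (by simp) h).trans
      (ih.mono fun f hf => hf.trans_le (Nat.le_add_left _ _))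

theorem conn_iff_mem_support (p : L.Route u v) : Conn p.mult u w ↔ w ∈ p.support := by
  refine ⟨fun h => h.of_invariant p.start_mem_support fun e _ _ he hj _ =>
    mem_support_of_joins (mult_pos.1 he) hj, fun hw => ?_⟩
  obtain ⟨q, r, hqr⟩ := p.exists_split_of_mem_support hw
  rw [hqr]
  exact q.conn.mono fun e he => he.trans_le (Nat.le_add_right _ _)

theorem conn_of_mult_eq_one {T : L.Edge → ℕ} (p : L.Route u u) {e : L.Edge} (he : p.mult e = 1)
    (hT : ∀ f, f ≠ e → 0 < p.mult f → 0 < T f) : Conn T e.fst e.snd := by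
  obtain ⟨a, b, q, r, hj, hqr⟩ := p.exists_split_of_mem_edges (mult_pos.1 (by omega : 0 < p.mult e))
  have hsum (f) : p.mult f = q.mult f + (Pi.single e 1 : L.Edge → ℕ) f + r.mult f := congrFun hqr f
  have hnot : q.mult e = 0 ∧ r.mult e = 0 := by
    have := hsum e
    rw [Pi.single_eq_same] at this
    omega
  have hpos (f) (hf : 0 < q.mult f ∨ 0 < r.mult f) : 0 < T f :=
    hT f (by rintro rfl; omega) (by have := hsum f; omega)
  have hba : Conn T b a :=
    (r.conn.mono fun f hf => hpos f (.inr hf)).trans (q.conn.mono fun f hf => hpos f (.inl hf))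
  rcases hj with ⟨rfl, rfl⟩ | ⟨rfl, rfl⟩
  · exact hba.symm
  · exact hba

theorem exists_mult_le_of_boundary {T : L.Edge → ℕ}
    (hT : boundary T = Pi.single u 1 + Pi.single v 1) : ∃ p : L.Route u v, p.mult ≤ T := by
  induction T using WellFoundedLT.induction generalizing u with
  | ind T ih =>
  by_cases huv : u = v
  · subst huv
    exact ⟨nil u, by rw [mult_nil]; exact zero_le⟩
  obtain ⟨e, w, he, hj⟩ := exists_joins_of_boundary_ne_zero (T := T) (u := u) (by simp [hT, huv])
  obtain ⟨R, rfl⟩ := exists_add_of_le (single_le he)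
  rw [boundary_add, boundary_single, hj.boundary_eq, add_assoc, add_right_inj] at hT
  obtain ⟨p, hp⟩ := ih R (lt_add_of_pos_left _ (by simp)) (u := w) (by
    rw [← hT, ← add_assoc, ZModModule.add_self, zero_add])
  exact ⟨cons e hj p, by rw [mult_cons]; exact add_le_add_right hp _⟩

theorem exists_mult_lt {T : L.Edge → ℕ} (hT : boundary T = 0) (p : L.Route u u) (hp : p.mult ≤ T)
    {e : L.Edge} (he : p.mult e < T e) (hj : e.Joins v w) (hv : v ∈ p.support) :
    ∃ q : L.Route u u, q.mult ≤ T ∧ p.mult < q.mult := by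
  obtain ⟨R, rfl⟩ := exists_add_of_le hp
  obtain ⟨R, rfl⟩ := exists_add_of_le (single_le (Nat.lt_add_right_iff_pos.1 he))
  rw [boundary_add, p.boundary_mult_closed, zero_add, boundary_add, boundary_single,
    hj.boundary_eq] at hT
  obtain ⟨c, hc⟩ := exists_mult_le_of_boundary (T := R) (u := w) (v := v) (by
    rw [add_comm (Pi.single w 1), ← sub_eq_zero, ZModModule.sub_eq_add, add_comm, hT])
  obtain ⟨q, r, hqr⟩ := p.exists_split_of_mem_support hv
  have hmult : (q.append ((cons e hj c).append r)).mult = p.mult + (Pi.single e 1 + c.mult) := by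
    rw [mult_append, mult_append, mult_cons, hqr]
    abel
  refine ⟨_, hmult.le.trans (by gcongr), ?_⟩
  rw [hmult]
  exact lt_add_of_pos_right _ (add_pos_of_pos_of_nonneg (by simp) zero_le)

/-- Euler's theorem.  A maximal closed walk inside `T` uses up `T`, because it can be extended at
each of its vertices that still has an unused edge. -/
theorem exists_mult_eq {T : L.Edge → ℕ} (hT : boundary T = 0)
    (hconn : ∀ e, 0 < T e → Conn T u e.fst) : ∃ p : L.Route u u, p.mult = T := by
  have hfin : {S | ∃ p : L.Route u u, p.mult = S ∧ S ≤ T}.Finite :=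
    (Set.finite_Icc 0 T).subset fun S ⟨_, _, hS⟩ => ⟨zero_le, hS⟩
  obtain ⟨_, ⟨p, rfl, hp⟩, hmax⟩ := hfin.exists_maximal ⟨0, nil u, mult_nil u, zero_le⟩
  have hused {e : L.Edge} {v w : L.Vertex} (hj : e.Joins v w) (hv : v ∈ p.support) :
      T e ≤ p.mult e := by
    by_contra! he
    obtain ⟨q, hq, hlt⟩ := p.exists_mult_lt hT hp he hj hv
    exact hlt.not_ge (hmax ⟨q, rfl, hq⟩ hlt.le)
  have hreach {v : L.Vertex} (hv : Conn T u v) : v ∈ p.support :=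
    hv.of_invariant p.start_mem_support fun e a b he hj ha =>
      mem_support_of_joins (mult_pos.1 (he.trans_le (hused hj ha))) hj
  refine ⟨p, le_antisymm hp fun e => ?_⟩
  rcases Nat.eq_zero_or_pos (T e) with h0 | he
  · rw [h0]; exact zero_le
  · exact hused e.joins_fst_snd (hreach (hconn e he))

end Route

/-! ### Rectangles and shifts -/

theorem Route.exists_mult_eq_single (e : L.Edge) :
    ∃ p : L.Route e.fst e.snd, p.mult = Pi.single e 1 :=
  ⟨cons e e.joins_fst_snd (nil _), by rw [mult_cons, mult_nil, add_zero]⟩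

theorem Route.exists_mult_eq_sum {N : ℕ} (f : Fin (N + 1) → L.Vertex) (M : Fin N → L.Edge → ℕ)
    (h : ∀ j, ∃ p : L.Route (f j.castSucc) (f j.succ), p.mult = M j) (b : Fin (N + 1)) :
    ∃ p : L.Route (f 0) (f b), p.mult = ∑ j with j.castSucc < b, M j := by
  induction b using Fin.induction with
  | zero => exact ⟨nil _, by simp [mult_nil]⟩
  | succ b ih =>
    obtain ⟨p, hp⟩ := ih
    obtain ⟨q, hq⟩ := h b
    have hfilter : ({j | j.castSucc < b.succ} : Finset (Fin N)) =
        insert b ({j | j.castSucc < b.castSucc} : Finset (Fin N)) := by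
      ext j
      simp [le_iff_eq_or_lt]
    exact ⟨p.append q, by rw [mult_append, hp, hq, hfilter, Finset.sum_insert (by simp), add_comm]⟩

theorem exists_route_subaisle (i : Fin (m + 1)) (k : Fin (n + 1)) :
    ∃ p : L.Route (.node i k.castSucc) (.node i k.succ),
      p.mult = ∑ j, Pi.single (.vert i k j) 1 := by
  have h := Route.exists_mult_eq_sum (L.site i k) _
    (fun j => Route.exists_mult_eq_single (.vert i k j)) (Fin.last _)
  simp only [Fin.castSucc_lt_last, Finset.filter_true] at h
  rwa [show L.site i k (Fin.last _) = .node i k.succ from Edge.snd_vert_last i k] at h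

/-- The part of aisle `i` above cross-aisle `b`, each edge taken once. -/
def col (i : Fin (m + 1)) (b : Fin (n + 2)) : L.Edge → ℕ
  | .horiz _ _ => 0
  | .vert i' k _ => if i' = i ∧ k.castSucc < b then 1 else 0

theorem sum_single_vert_apply (i i' : Fin (m + 1)) (k k' : Fin (n + 1))
    (j' : Fin (L.numPicks i' k' + 1)) :
    (∑ j, Pi.single (.vert i k j) 1 : L.Edge → ℕ) (.vert i' k' j') =
      if i' = i ∧ k' = k then 1 else 0 := by
  rw [Finset.sum_apply]
  split_ifs with h
  · obtain ⟨rfl, rfl⟩ := h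
    simp [Pi.single_apply]
  · exact Finset.sum_eq_zero fun j _ =>
      Pi.single_eq_of_ne (fun he => h (by cases he; exact ⟨rfl, rfl⟩)) _

theorem col_eq_sum (i : Fin (m + 1)) (b : Fin (n + 2)) :
    (col i b : L.Edge → ℕ) = ∑ k with k.castSucc < b, ∑ j, Pi.single (.vert i k j) 1 := by
  ext e
  cases e with
  | horiz g c => simp [col]
  | vert i' k j =>
    rw [Finset.sum_apply]
    simp only [sum_single_vert_apply, col]
    by_cases hi : i' = i <;> simp [hi]

theorem exists_route_col (i : Fin (m + 1)) {b x y : Fin (n + 2)} (hxy : s(x, y) = s(0, b)) :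
    ∃ p : L.Route (.node i x) (.node i y), p.mult = col i b := by
  obtain ⟨p, hp⟩ := Route.exists_mult_eq_sum (fun c => (.node i c : L.Vertex)) _
    (exists_route_subaisle i) b
  rw [← col_eq_sum] at hp
  rcases Sym2.eq_iff.1 hxy with ⟨rfl, rfl⟩ | ⟨rfl, rfl⟩
  · exact ⟨p, hp⟩
  · exact ⟨p.reverse, p.mult_reverse.trans hp⟩

theorem totalLength_col (i : Fin (m + 1)) (b : Fin (n + 2)) :
    L.totalLength (col i b) = ∑ k with k.castSucc < b, L.height k := by
  simp [totalLength, col, ite_and, Finset.sum_filter, sum_segLength]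

/-- Half of the boundary of the rectangle between two neighbouring aisles, cross-aisle `0` and
cross-aisle `b`: its side along aisle `i` and its side along cross-aisle `x`, over gap `g`. -/
def hook (g : Fin m) (i : Fin (m + 1)) (b x : Fin (n + 2)) : L.Edge → ℕ :=
  col i b + Pi.single (.horiz g x) 1

theorem totalLength_hook (g : Fin m) (i : Fin (m + 1)) (b x : Fin (n + 2)) :
    L.totalLength (hook g i b x) = (∑ k with k.castSucc < b, L.height k) + L.spacing g := by
  rw [hook, totalLength_add, totalLength_col, totalLength_single]
  rfl

theorem exists_route_rectangle {g : Fin m} {i i' : Fin (m + 1)} {b x y : Fin (n + 2)}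
    (hg : Separates g i i') (hxy : s(x, y) = s(0, b)) :
    ∃ p : L.Route (.node i x) (.node i x), p.mult = hook g i b x + hook g i' b y := by
  obtain ⟨p, hp⟩ := exists_route_col (L := L) i hxy
  obtain ⟨q, hq⟩ := exists_route_col (L := L) i' (Sym2.eq_swap.trans hxy)
  refine ⟨p.append (.cons _ (hg.joins y) (q.append (.cons _ (hg.symm.joins x) (.nil _)))), ?_⟩
  rw [Route.mult_append, Route.mult_cons, Route.mult_append, Route.mult_cons, Route.mult_nil, hp,
    hq, hook, hook]
  abel

theorem smul_hook_le {T : L.Edge → ℕ} {g : Fin m} {i : Fin (m + 1)} {b x : Fin (n + 2)} {c : ℕ}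
    (hcol : c • col i b ≤ T) (hx : c ≤ T (.horiz g x)) : c • hook g i b x ≤ T := by
  intro e
  by_cases he : e = .horiz g x
  · subst he
    simpa [hook, col] using hx
  · simpa [hook, he] using hcol e

theorem hook_le {T : L.Edge → ℕ} {g : Fin m} {i : Fin (m + 1)} {b x : Fin (n + 2)}
    (hcol : 2 • col i b ≤ T) (hx : 0 < T (.horiz g x)) : hook g i b x ≤ T := by
  have hcol' : 1 • col i b ≤ T := (smul_le_smul_of_nonneg_right one_le_two zero_le).trans hcol
  rw [← one_smul ℕ (hook g i b x)]
  exact smul_hook_le hcol' hx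

/-- The multigraph obtained from `T` by moving the side along aisle `i` of the rectangle below
cross-aisle `0` to aisle `i'`, and its side along cross-aisle `x` to cross-aisle `y`.  The
subtraction is only meaningful when `hook g i b x ≤ T`. -/
def shift (T : L.Edge → ℕ) (g : Fin m) (i i' : Fin (m + 1)) (b x y : Fin (n + 2)) : L.Edge → ℕ :=
  T + hook g i' b y - hook g i b x

section Shift

variable {T : L.Edge → ℕ} {g : Fin m} {i i' : Fin (m + 1)} {b x y : Fin (n + 2)}

theorem shift_add_hook (h : hook g i b x ≤ T) :
    shift T g i i' b x y + hook g i b x = T + hook g i' b y :=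
  tsub_add_cancel_of_le (h.trans le_self_add)

theorem totalLength_shift (h : hook g i b x ≤ T) :
    L.totalLength (shift T g i i' b x y) = L.totalLength T := by
  have := congrArg L.totalLength (shift_add_hook (i' := i') (y := y) h)
  rwa [totalLength_add, totalLength_add, totalLength_hook, totalLength_hook, add_left_inj] at this

theorem shift_horiz_left (hxy : x ≠ y) :
    shift T g i i' b x y (.horiz g x) = T (.horiz g x) - 1 := by
  simp [shift, hook, col, hxy.symm]

theorem shift_horiz_right (hxy : x ≠ y) :
    shift T g i i' b x y (.horiz g y) = T (.horiz g y) + 1 := by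
  simp [shift, hook, col, hxy]

theorem shift_vert_left (hi : i ≠ i') {k : Fin (n + 1)} (hk : k.castSucc < b)
    (j : Fin (L.numPicks i k + 1)) :
    shift T g i i' b x y (.vert i k j) = T (.vert i k j) - 1 := by
  simp [shift, hook, col, hi, hk]

theorem shift_vert_of_ne {a : Fin (m + 1)} (hi : a ≠ i) (hi' : a ≠ i') {k : Fin (n + 1)}
    (j : Fin (L.numPicks a k + 1)) :
    shift T g i i' b x y (.vert a k j) = T (.vert a k j) := by
  simp [shift, hook, col, hi, hi']

theorem shift_vert_of_le {a : Fin (m + 1)} {k : Fin (n + 1)} (hk : b ≤ k.castSucc)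
    (j : Fin (L.numPicks a k + 1)) :
    shift T g i i' b x y (.vert a k j) = T (.vert a k j) := by
  simp [shift, hook, col, hk.not_gt]

end Shift

theorem conn_of_forall_pos {T : L.Edge → ℕ} (hT : ∀ e, 0 < T e) (u v : L.Vertex) : Conn T u v := by
  have hsite (i : Fin (m + 1)) (k : Fin (n + 1)) (j : Fin (L.numPicks i k + 2)) :
      Conn T (.node i k.castSucc) (L.site i k j) := by
    induction j using Fin.induction with
    | zero => exact .refl _ _
    | succ j ih => exact ih.trans (.of_joins (hT (.vert i k j)) (.inl ⟨rfl, rfl⟩))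
  have hnode (i : Fin (m + 1)) (c : Fin (n + 2)) : Conn T (.node 0 0) (.node i c) := by
    induction c using Fin.induction with
    | zero =>
      induction i using Fin.induction with
      | zero => exact .refl _ _
      | succ g ih => exact ih.trans (.of_joins (hT (.horiz g 0)) (.inl ⟨rfl, rfl⟩))
    | succ k ih =>
      rw [← Edge.snd_vert_last]
      exact ih.trans (hsite i k _)
  have hroot (v : L.Vertex) : Conn T (.node 0 0) v := by
    cases v with
    | node i c => exact hnode i c
    | pick i k j =>
      rw [← Edge.snd_vert_castSucc]
      exact (hnode i k.castSucc).trans (hsite i k _)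
  exact (hroot u).symm.trans (hroot v)

theorem update_zero_modEq {T : L.Edge → ℕ} {e : L.Edge} (he : Even (T e)) (f : L.Edge) :
    Function.update T e 0 f ≡ T f [MOD 2] := by
  rcases eq_or_ne f e with rfl | hfe
  · rw [Function.update_self]
    exact (Nat.modEq_zero_iff_dvd.2 he.two_dvd).symm
  · rw [Function.update_of_ne hfe]

/-- The least multigraph with the same edges and the same parities as `T`. -/
def reduce (T : L.Edge → ℕ) (e : L.Edge) : ℕ := if T e = 0 then 0 else 2 - T e % 2

theorem reduce_le (T : L.Edge → ℕ) : reduce T ≤ T := fun e => by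
  dsimp only [reduce]
  split_ifs <;> omega

theorem reduce_le_two (T : L.Edge → ℕ) (e : L.Edge) : reduce T e ≤ 2 := by
  dsimp only [reduce]
  split_ifs <;> omega

theorem even_add_of_pick {T : L.Edge → ℕ} (hT : boundary T = 0) (i : Fin (m + 1)) (k : Fin (n + 1))
    (j : Fin (L.numPicks i k)) : Even (T (.vert i k j.castSucc) + T (.vert i k j.succ)) :=
  even_add_of_boundary_eq_zero (congrFun hT (.pick i k j)) (by simp [j.castSucc_lt_succ.ne])
    (.inr ⟨rfl, Edge.snd_vert_castSucc i k j⟩) (.inl ⟨Edge.fst_vert_succ i k j, rfl⟩)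
    fun _ _ _ h => h.eq_of_pick

theorem even_add_of_node {T : L.Edge → ℕ} (hT : boundary T = 0) {i : Fin (m + 1)} {k : Fin n}
    (h0 : ∀ g i', Separates g i i' → T (.horiz g k.castSucc.succ) = 0) :
    Even (T (.vert i k.castSucc (Fin.last _)) + T (.vert i k.succ 0)) := by
  refine even_add_of_boundary_eq_zero (congrFun hT (.node i k.castSucc.succ))
    (by simp [k.castSucc_lt_succ.ne]) (.inr ⟨rfl, Edge.snd_vert_last i _⟩) (.inl ⟨rfl, rfl⟩)
    fun a x ha hj => ?_
  rcases hj.eq_of_node with ⟨g, i', hg, rfl⟩ | ⟨k', hk', rfl⟩ | ⟨k', hk', rfl⟩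
  · exact absurd (h0 g i' hg) ha.ne'
  · obtain rfl : k' = k.succ := Fin.castSucc_injective _ hk'
    exact Or.inr rfl
  · obtain rfl : k' = k.castSucc := Fin.succ_injective _ hk'
    exact Or.inl rfl

theorem exists_horiz_ne_of_eq_one {T : L.Edge → ℕ} (hT : boundary T = 0) {g : Fin m}
    {i i' : Fin (m + 1)} (hg : Separates g i i') (h1 : T (.horiz g 0) = 1)
    (h2 : Even (T (.vert i 0 0))) :
    ∃ g' i'', Separates g' i i'' ∧ g' ≠ g ∧ 0 < T (.horiz g' 0) := by
  by_contra! hcon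
  have heven : Even (T (.horiz g 0) + T (.vert i 0 0)) :=
    even_add_of_boundary_eq_zero (congrFun hT (.node i 0)) (by simp) (hg.joins 0) (.inl ⟨rfl, rfl⟩)
      fun a x ha hj => by
    rcases hj.eq_of_node with ⟨g', i'', hg', rfl⟩ | ⟨k, hk, rfl⟩ | ⟨k, hk, -⟩
    · by_contra! hne
      exact ha.not_ge (hcon g' i'' hg' (by rintro rfl; exact hne.1 rfl))
    · obtain rfl : k = 0 := Fin.castSucc_injective _ hk
      exact Or.inr rfl
    · exact absurd hk (Fin.succ_ne_zero k)
  rw [h1, Nat.even_add] at heven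
  exact Nat.not_even_one (heven.2 h2)

end Layout

namespace Warehouse

open Layout

variable {m n : ℕ} {W : Warehouse m n} {S T : W.Edge → ℕ}

/-! ### Tour subgraphs -/

theorem isTourSubgraph_iff : W.IsTourSubgraph T ↔ boundary T = 0 ∧
    (∀ v, W.Required v → Conn T W.depot v) ∧ ∀ e, 0 < T e → Conn T W.depot e.fst := by
  constructor
  · rintro ⟨p, hp, hcount⟩
    obtain rfl : T = p.mult := funext hcount
    exact ⟨p.boundary_mult_closed, fun v hv => p.conn_iff_mem_support.2 (hp v hv), fun e he =>
      p.conn_iff_mem_support.2 (Route.mem_support_of_joins (Route.mult_pos.1 he)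
        e.joins_fst_snd.symm)⟩
  · rintro ⟨hT, hreq, hconn⟩
    obtain ⟨p, rfl⟩ := Route.exists_mult_eq hT hconn
    exact ⟨p, fun v hv => p.conn_iff_mem_support.1 (hreq v hv), fun _ => rfl⟩

namespace IsTourSubgraph

theorem boundary_eq_zero (hT : W.IsTourSubgraph T) : boundary T = 0 := (isTourSubgraph_iff.1 hT).1

theorem conn_of_required (hT : W.IsTourSubgraph T) {v : W.Vertex} (hv : W.Required v) :
    Conn T W.depot v :=
  (isTourSubgraph_iff.1 hT).2.1 v hv

theorem conn_of_joins (hT : W.IsTourSubgraph T) {e : W.Edge} {u v : W.Vertex} (he : 0 < T e)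
    (hj : e.Joins u v) : Conn T W.depot u := by
  have hfst := (isTourSubgraph_iff.1 hT).2.2 e he
  rcases hj with ⟨rfl, -⟩ | ⟨-, rfl⟩
  · exact hfst
  · exact hfst.trans (.of_joins he e.joins_fst_snd)

theorem of_map (hS : W.IsTourSubgraph S) (hT : boundary T = 0) (f : W.Vertex → W.Vertex)
    (hf : ∀ e, 0 < S e → Conn T (f e.fst) (f e.snd)) (hreq : ∀ v, W.Required v → f v = v)
    (hend : ∀ e, 0 < T e → 0 < S e ∧ f e.fst = e.fst) : W.IsTourSubgraph T := by
  have hdepot : f W.depot = W.depot := hreq _ (.inl rfl)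
  refine isTourSubgraph_iff.2 ⟨hT, fun v hv => ?_, fun e he => ?_⟩
  · have := (hS.conn_of_required hv).map f hf
    rwa [hdepot, hreq v hv] at this
  · have := (hS.conn_of_joins (hend e he).1 e.joins_fst_snd).map f hf
    rwa [hdepot, (hend e he).2] at this

theorem of_le (hS : W.IsTourSubgraph S) (hle : T ≤ S) (hmod : ∀ e, T e ≡ S e [MOD 2])
    (hconn : ∀ e, 0 < S e → Conn T e.fst e.snd) : W.IsTourSubgraph T :=
  hS.of_map ((boundary_congr hmod).trans hS.boundary_eq_zero) id hconn (fun _ _ => rfl)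
    fun e he => ⟨he.trans_le (hle e), rfl⟩

theorem add_mult (hT : W.IsTourSubgraph T) {u : W.Vertex} (p : W.Route u u)
    (hu : Conn T W.depot u) : W.IsTourSubgraph (T + p.mult) := by
  have hmono {v w : W.Vertex} (h : Conn T v w) : Conn (T + p.mult) v w :=
    h.mono fun e he => he.trans_le (Nat.le_add_right _ _)
  refine isTourSubgraph_iff.2 ⟨?_, fun v hv => hmono (hT.conn_of_required hv), fun e he => ?_⟩
  · rw [boundary_add, hT.boundary_eq_zero, p.boundary_mult_closed, add_zero]
  rcases Nat.add_pos_iff_pos_or_pos.1 he with he | he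
  · exact hmono (hT.conn_of_joins he e.joins_fst_snd)
  · refine (hmono hu).trans (Conn.mono (fun f hf => hf.trans_le (Nat.le_add_left _ _)) ?_)
    exact p.conn_iff_mem_support.2
      (Route.mem_support_of_joins (Route.mult_pos.1 he) e.joins_fst_snd.symm)

/-- An edge of a cycle may be dropped, since the rest of the cycle still joins its ends. -/
theorem of_le_of_closed (hS : W.IsTourSubgraph S) (hle : T ≤ S) (hmod : ∀ e, T e ≡ S e [MOD 2])
    {u : W.Vertex} (p : W.Route u u) {e : W.Edge} (he : p.mult e = 1) (hp : p.mult ≤ S)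
    (hpos : ∀ f, f ≠ e → 0 < S f → 0 < T f) : W.IsTourSubgraph T := by
  refine hS.of_le hle hmod fun f hf => ?_
  rcases eq_or_ne f e with rfl | hfe
  · exact p.conn_of_mult_eq_one he fun a ha hpa => hpos a ha (hpa.trans_le (hp a))
  · exact .of_joins (hpos f hfe hf) f.joins_fst_snd

theorem shift (hT : W.IsTourSubgraph T) {g : Fin m} {i i' : Fin (m + 1)} {b x y : Fin (n + 2)}
    (hg : Separates g i i') (hb : b ≠ 0) (hxy : s(x, y) = s(0, b)) (hx : 0 < T (.horiz g x))
    (hcol : 2 • col i b ≤ T) : W.IsTourSubgraph (shift T g i i' b x y) := by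
  have hxy' : x ≠ y := by
    rcases Sym2.eq_iff.1 hxy with ⟨rfl, rfl⟩ | ⟨rfl, rfl⟩
    exacts [hb.symm, hb]
  obtain ⟨p, hp⟩ := exists_route_rectangle (L := W.toLayout) hg hxy
  have hadd := shift_add_hook (i' := i') (y := y) (hook_le hcol hx)
  have hsum : T + p.mult = Layout.shift T g i i' b x y + 2 • hook g i b x := by
    rw [hp, two_smul, ← add_assoc (Layout.shift T g i i' b x y), hadd]
    abel
  refine (hT.add_mult p (hT.conn_of_joins hx (hg.joins x))).of_le_of_closed
    (hsum ▸ le_self_add) (fun f => ?_) p (e := .horiz g x) ?_ le_add_self fun f hf hpos => ?_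
  · rw [hsum]
    simp [Nat.ModEq]
  · rw [hp]
    simp [hook, col, hxy']
  · have h1 := congrFun hadd f
    have h2 := hcol f
    have h3 : hook g i b x f = col i b f := by simp [hook, hf]
    rw [hp] at hpos
    simp only [Pi.add_apply, Pi.smul_apply, smul_eq_mul] at h1 h2 hpos
    omega

/-- A dead end that need not be visited is removed by retracting it to its neighbour. -/
theorem update_zero (hT : W.IsTourSubgraph T) {e : W.Edge} {u w : W.Vertex} (hj : e.Joins u w)
    (hu : ¬ W.Required u) (he : T e = 2) (hend : ∀ f v, 0 < T f → f.Joins u v → f = e) :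
    W.IsTourSubgraph (Function.update T e 0) := by
  have hne {f : W.Edge} (hf : 0 < T f) (hfe : f ≠ e) : f.fst ≠ u ∧ f.snd ≠ u :=
    ⟨fun h => hfe (hend f _ hf (.inl ⟨h, rfl⟩)), fun h => hfe (hend f _ hf (.inr ⟨rfl, h⟩))⟩
  refine hT.of_map ((boundary_congr (update_zero_modEq (he ▸ even_two))).trans hT.boundary_eq_zero)
    (fun v => if v = u then w else v) (fun f hf => ?_)
    (fun v hv => if_neg (by rintro rfl; exact hu hv)) fun f hf => ?_
  · rcases eq_or_ne f e with rfl | hfe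
    · have hwu : w ≠ u := hj.ne.symm
      rcases hj with ⟨h, h'⟩ | ⟨h, h'⟩ <;> simp [h, h', hwu, Conn.refl]
    · rw [if_neg (hne hf hfe).1, if_neg (hne hf hfe).2]
      exact .of_joins (by rwa [Function.update_of_ne hfe]) f.joins_fst_snd
  · rcases eq_or_ne f e with rfl | hfe
    · simp at hf
    · rw [Function.update_of_ne hfe] at hf
      exact ⟨hf, if_neg (hne hf hfe).1⟩

end IsTourSubgraph

theorem IsTourSubgraph.reduce (hT : W.IsTourSubgraph T) : W.IsTourSubgraph (reduce T) := by
  refine hT.of_le (reduce_le T) (fun e => ?_) fun e he => .of_joins ?_ e.joins_fst_snd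
  · simp only [Layout.reduce, Nat.ModEq]
    split_ifs <;> omega
  · rw [Layout.reduce, if_neg he.ne']
    omega

theorem IsMinTourSubgraph.not_lt (hT : W.IsMinTourSubgraph T) (hS : W.IsTourSubgraph S) :
    ¬ S < T :=
  fun h => (hT.2 S hS).not_gt (totalLength_strictMono h)

theorem IsMinTourSubgraph.le_two (hT : W.IsMinTourSubgraph T) (e : W.Edge) : T e ≤ 2 := by
  rw [← eq_of_le_of_not_lt (reduce_le T) (hT.not_lt hT.1.reduce)]
  exact reduce_le_two T e

theorem exists_isMinTourSubgraph (W : Warehouse m n) : ∃ T, W.IsMinTourSubgraph T := by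
  have hboundary : boundary (fun _ : W.Edge => 2) = 0 :=
    (boundary_congr (T := 0) fun _ => Nat.modEq_zero_iff_dvd.2 dvd_rfl).trans boundary_zero
  have hconn (u v : W.Vertex) : Conn (fun _ : W.Edge => 2) u v :=
    conn_of_forall_pos (fun _ => two_pos) u v
  have htwo : W.IsTourSubgraph fun _ => 2 :=
    isTourSubgraph_iff.2 ⟨hboundary, fun _ _ => hconn _ _, fun _ _ => hconn _ _⟩
  have hfin : {T | W.IsTourSubgraph T ∧ ∀ e, T e ≤ 2}.Finite :=
    (Set.finite_Iic fun _ => 2).subset fun T hT => hT.2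
  obtain ⟨T, ⟨hT, -⟩, hmin⟩ := hfin.exists_minimalFor W.totalLength _ ⟨_, htwo, fun _ => le_rfl⟩
  refine ⟨T, hT, fun S hS => ?_⟩
  have hle := totalLength_strictMono.monotone (reduce_le S)
  exact (le_of_not_gt fun h => (hmin ⟨hS.reduce, reduce_le_two S⟩ h.le).not_gt h).trans hle

end Warehouse

namespace Layout

variable {m n : ℕ} {L : Layout m n} {T : L.Edge → ℕ}

/-! ### Extremal tour subgraphs -/

theorem Separates.neighbor_ne {g g' : Fin m} {i a a' : Fin (m + 1)} (h : Separates g i a)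
    (h' : Separates g' i a') (hne : g ≠ g') : a ≠ a' := by
  simp only [Separates, Fin.ext_iff, Fin.val_castSucc, Fin.val_succ, ne_eq] at *
  omega

theorem Separates.eq_or_eq {g a a' : Fin m} {i i₀ i₁ i₂ : Fin (m + 1)} (h : Separates g i i₀)
    (ha : Separates a i i₁) (ha' : Separates a' i i₂) (hne : a ≠ a') : g = a ∨ g = a' := by
  simp only [Separates, Fin.ext_iff, Fin.val_castSucc, Fin.val_succ, ne_eq] at *
  omega

/-- Every edge of aisle `i` above cross-aisle `b` is traversed twice. -/
def ColumnDoubled (T : L.Edge → ℕ) (i : Fin (m + 1)) (b : Fin (n + 2)) : Prop :=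
  ∀ k : Fin (n + 1), k.castSucc < b → ∀ j, T (.vert i k j) = 2

theorem columnDoubled_zero (T : L.Edge → ℕ) (i : Fin (m + 1)) : ColumnDoubled T i 0 :=
  fun _ hk => absurd hk (Fin.not_lt_zero _)

theorem columnDoubled_succ {i : Fin (m + 1)} {k : Fin (n + 1)} :
    ColumnDoubled T i k.succ ↔ ColumnDoubled T i k.castSucc ∧ ∀ j, T (.vert i k j) = 2 := by
  simp only [ColumnDoubled, Fin.castSucc_lt_succ_iff, Fin.castSucc_lt_castSucc_iff,
    le_iff_lt_or_eq, or_imp, forall_and, forall_eq]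

theorem columnDoubled_one {i : Fin (m + 1)} :
    ColumnDoubled T i 1 ↔ ∀ j, T (.vert i 0 j) = 2 :=
  (columnDoubled_succ (k := 0)).trans (and_iff_right (columnDoubled_zero T i))

theorem ColumnDoubled.two_smul_col_le {i : Fin (m + 1)} {b : Fin (n + 2)}
    (h : ColumnDoubled T i b) : 2 • col i b ≤ T := by
  intro e
  cases e with
  | horiz g c => simp [col]
  | vert i' k j =>
    by_cases hk : i' = i ∧ k.castSucc < b
    · obtain ⟨rfl, hk⟩ := hk
      simp [col, hk, h k hk j]
    · simp [col, hk]

/-- All edges of the aisle of a vertex above that vertex are traversed twice. -/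
def DoubledAbove (T : L.Edge → ℕ) : L.Vertex → Prop
  | .node i c => ColumnDoubled T i c
  | .pick i k j => ColumnDoubled T i k.castSucc ∧ ∀ j' ≤ j.castSucc, T (.vert i k j') = 2

theorem doubledAbove_fst_vert {i : Fin (m + 1)} {k : Fin (n + 1)} {j : Fin (L.numPicks i k + 1)} :
    DoubledAbove T (Edge.vert i k j).fst ↔
      ColumnDoubled T i k.castSucc ∧ ∀ j' < j, T (.vert i k j') = 2 := by
  cases j using Fin.cases with
  | zero => simp [Edge.fst_vert_zero, DoubledAbove]
  | succ j => simp only [Edge.fst_vert_succ, DoubledAbove, Fin.le_castSucc_iff]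

theorem doubledAbove_snd_vert {i : Fin (m + 1)} {k : Fin (n + 1)} {j : Fin (L.numPicks i k + 1)} :
    DoubledAbove T (Edge.vert i k j).snd ↔
      ColumnDoubled T i k.castSucc ∧ ∀ j' ≤ j, T (.vert i k j') = 2 := by
  cases j using Fin.lastCases with
  | last => simp [Edge.snd_vert_last, DoubledAbove, columnDoubled_succ, Fin.le_last]
  | cast j => rw [Edge.snd_vert_castSucc, DoubledAbove]

theorem doubledAbove_snd_vert_iff {i : Fin (m + 1)} {k : Fin (n + 1)}
    {j : Fin (L.numPicks i k + 1)} : DoubledAbove T (Edge.vert i k j).snd ↔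
      DoubledAbove T (Edge.vert i k j).fst ∧ T (.vert i k j) = 2 := by
  simp only [doubledAbove_fst_vert, doubledAbove_snd_vert, le_iff_lt_or_eq, or_imp, forall_and,
    forall_eq, and_assoc]

theorem eq_two_of_doubledAbove {i : Fin (m + 1)} (hT : boundary T = 0) (h2 : ∀ e, T e ≤ 2)
    (hX : ColumnDoubled T i 1)
    (h0 : ∀ c g i', ColumnDoubled T i c → Separates g i i' → T (.horiz g c) = 0)
    {k : Fin (n + 1)} {j : Fin (L.numPicks i k + 1)} (hpos : 0 < T (.vert i k j))
    (h : DoubledAbove T (Edge.vert i k j).fst) : T (.vert i k j) = 2 := by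
  have htwo {a : ℕ} (ha : a = 2) (heven : Even (a + T (.vert i k j))) : T (.vert i k j) = 2 := by
    subst ha
    obtain ⟨r, hr⟩ := heven
    have := h2 (.vert i k j)
    omega
  cases j using Fin.cases with
  | zero =>
    cases k using Fin.cases with
    | zero => exact columnDoubled_one.1 hX 0
    | succ k =>
      exact htwo ((columnDoubled_succ (k := k.castSucc)).1 h |>.2 _)
        (even_add_of_node hT fun g i' hg => h0 _ g i' h hg)
  | succ j =>
    exact htwo ((doubledAbove_fst_vert.1 h).2 _ j.castSucc_lt_succ) (even_add_of_pick hT i k j)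

/-- The doubled subaisles of the upper and the lower block. -/
def outerDoubled (T : L.Edge → ℕ) : Finset (Fin (m + 1) × Fin (n + 1)) :=
  {x | (x.2 = 0 ∨ x.2 = Fin.last n) ∧ ∀ j, T (.vert x.1 x.2 j) = 2}

theorem mem_outerDoubled {i : Fin (m + 1)} {k : Fin (n + 1)} :
    (i, k) ∈ outerDoubled T ↔ (k = 0 ∨ k = Fin.last n) ∧ ∀ j, T (.vert i k j) = 2 := by
  simp [outerDoubled]

theorem outerDoubled_shift_subset {g : Fin m} {i i' : Fin (m + 1)} {b : Fin (n + 2)}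
    (x y : Fin (n + 2)) (hi : i ≠ i') (hcol : ColumnDoubled T i b) :
    outerDoubled (shift T g i i' b x y) ⊆ (outerDoubled T).image
      fun z => if z.1 = i ∧ z.2.castSucc < b then (i', z.2) else z := by
  rintro ⟨a, k⟩ hak
  rw [mem_outerDoubled] at hak
  obtain ⟨hk, htwo⟩ := hak
  rcases le_or_gt b k.castSucc with hbk | hkb
  · refine Finset.mem_image.2 ⟨(a, k), mem_outerDoubled.2 ⟨hk, fun j => ?_⟩, by simp [hbk.not_gt]⟩
    rw [← htwo j, shift_vert_of_le hbk]
  have hai : a ≠ i := by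
    rintro rfl
    have := htwo 0
    rw [shift_vert_left hi hkb, hcol k hkb] at this
    omega
  rcases eq_or_ne a i' with rfl | hai'
  · exact Finset.mem_image.2 ⟨(i, k), mem_outerDoubled.2 ⟨hk, hcol k hkb⟩, by simp [hkb]⟩
  · refine Finset.mem_image.2 ⟨(a, k), mem_outerDoubled.2 ⟨hk, fun j => ?_⟩, by simp [hai]⟩
    rw [← htwo j, shift_vert_of_ne hai hai']

end Layout

namespace Warehouse

open Layout

variable {m n : ℕ} {W : Warehouse m n} {T : W.Edge → ℕ}

theorem aisleOf_fst_vert {i : Fin (m + 1)} {k : Fin (n + 1)} {j : Fin (W.numPicks i k + 1)} :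
    W.aisleOf (Edge.vert i k j).fst = i := by
  cases j using Fin.cases with
  | zero => rfl
  | succ j => rw [Edge.fst_vert_succ, aisleOf]

theorem aisleOf_snd_vert {i : Fin (m + 1)} {k : Fin (n + 1)} {j : Fin (W.numPicks i k + 1)} :
    W.aisleOf (Edge.vert i k j).snd = i := by
  cases j using Fin.lastCases with
  | last => rw [Edge.snd_vert_last, aisleOf]
  | cast j => rw [Edge.snd_vert_castSucc, aisleOf]

/-- Minimum tour subgraphs with as few doubled outer subaisles as possible. -/
def IsExtremal (W : Warehouse m n) (T : W.Edge → ℕ) : Prop :=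
  W.IsMinTourSubgraph T ∧
    ∀ S, W.IsMinTourSubgraph S → (outerDoubled T).card ≤ (outerDoubled S).card

namespace IsExtremal

variable {g : Fin m} {i i' : Fin (m + 1)} {b x y : Fin (n + 2)}

/-- The shift cannot increase the number of doubled outer subaisles, so it must not lose any. -/
theorem shift (h : W.IsExtremal T) (hg : Separates g i i') (hcol : ColumnDoubled T i b)
    (hx : 0 < T (.horiz g x)) (hb : b ≠ 0) (hxy : s(x, y) = s(0, b)) :
    W.IsExtremal (shift T g i i' b x y) ∧ ColumnDoubled (shift T g i i' b x y) i' 1 := by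
  have hmin : W.IsMinTourSubgraph (Layout.shift T g i i' b x y) :=
    ⟨h.1.1.shift hg hb hxy hx hcol.two_smul_col_le, fun S hS =>
      (totalLength_shift (hook_le hcol.two_smul_col_le hx)).trans_le (h.1.2 S hS)⟩
  have hsub := outerDoubled_shift_subset (g := g) x y hg.ne hcol
  have himage := Finset.eq_of_subset_of_card_le hsub (Finset.card_image_le.trans (h.2 _ hmin))
  refine ⟨⟨hmin, fun S hS => ?_⟩, columnDoubled_one.2 ?_⟩
  · exact ((Finset.card_le_card hsub).trans Finset.card_image_le).trans (h.2 S hS)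
  · have hb' : (0 : Fin (n + 1)).castSucc < b := Fin.pos_of_ne_zero hb
    refine (mem_outerDoubled.1 (himage ▸ Finset.mem_image.2 ⟨(i, 0), ?_, ?_⟩)).2
    · exact mem_outerDoubled.2 ⟨.inl rfl, hcol 0 hb'⟩
    · exact if_pos ⟨rfl, hb'⟩

/-- Otherwise, after the shift, the rectangle would be a cycle through a doubled edge, which could
be dropped. -/
theorem horiz_eq_one (h : W.IsExtremal T) (hX : ColumnDoubled T i 1) (hg : Separates g i i')
    (ht : 0 < T (.horiz g 0)) : T (.horiz g 0) = 1 := by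
  by_contra hne
  have htwo : 2 ≤ T (.horiz g 0) := by omega
  obtain ⟨h', hX'⟩ := h.shift hg hX ht one_ne_zero rfl
  obtain ⟨p, hp⟩ := exists_route_rectangle (L := W.toLayout) hg (x := 0) (y := 1) rfl
  have hrect : p.mult ≤ Layout.shift T g i i' 1 0 1 := by
    refine le_of_add_le_add_right (a := hook g i 1 0) ?_
    rw [hp, shift_add_hook (hook_le hX.two_smul_col_le ht), add_right_comm, ← two_smul ℕ]
    exact add_le_add_left (smul_hook_le hX.two_smul_col_le htwo) _
  have hdouble : Layout.shift T g i i' 1 0 1 (.vert i' 0 0) = 2 := columnDoubled_one.1 hX' 0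
  refine h'.1.not_lt (h'.1.1.of_le_of_closed (update_le_self_iff.2 zero_le)
    (update_zero_modEq (hdouble ▸ even_two)) p (e := .vert i' 0 0) ?_ hrect fun f hf hpos => ?_)
    (update_lt_self_iff.2 (by rw [hdouble]; exact two_pos))
  · rw [hp]
    simp [hook, col, hg.ne.symm]
  · rwa [Function.update_of_ne hf]

theorem exists_horiz (h : W.IsExtremal T) (hX : ColumnDoubled T i 1) (hd : W.depot ≠ .node i 0) :
    ∃ g i', Separates g i i' ∧ 0 < T (.horiz g 0) := by
  by_contra! hcon
  have hX0 : T (.vert i 0 0) = 2 := columnDoubled_one.1 hX 0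
  refine h.1.not_lt (h.1.1.update_zero (e := .vert i 0 0) (u := .node i 0) (.inl ⟨rfl, rfl⟩)
    ?_ hX0 fun f v hf hj => ?_) (update_lt_self_iff.2 (hX0 ▸ two_pos))
  · rintro (h0 | ⟨_, _, _, h0⟩)
    · exact hd h0.symm
    · cases h0
  · rcases hj.eq_of_node with ⟨g, i', hg, rfl⟩ | ⟨k, hk, rfl⟩ | ⟨k, hk, -⟩
    · exact absurd hf (hcon g i' hg).not_gt
    · obtain rfl : k = 0 := Fin.castSucc_injective _ hk
      rfl
    · exact absurd hk (Fin.succ_ne_zero k)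

theorem exists_horiz_ne (h : W.IsExtremal T) (hX : ColumnDoubled T i 1) (hg : Separates g i i')
    (ht : 0 < T (.horiz g 0)) : ∃ g' i'', Separates g' i i'' ∧ g' ≠ g ∧ 0 < T (.horiz g' 0) :=
  exists_horiz_ne_of_eq_one h.1.1.boundary_eq_zero hg (h.horiz_eq_one hX hg ht)
    (columnDoubled_one.1 hX 0 ▸ even_two)

theorem horiz_pos (h : W.IsExtremal T) (hX : ColumnDoubled T i 1) (hd : W.depot ≠ .node i 0)
    (hg : Separates g i i') : 0 < T (.horiz g 0) := by
  obtain ⟨a, i₁, ha, hta⟩ := h.exists_horiz hX hd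
  obtain ⟨a', i₂, ha', hne, hta'⟩ := h.exists_horiz_ne hX ha hta
  rcases hg.eq_or_eq ha' ha hne with rfl | rfl
  · exact hta'
  · exact hta

/-- Shifting to the neighbouring aisle across `g` uses up the edge over `g`. -/
theorem depot_eq_of_horiz_pos (h : W.IsExtremal T) (hX : ColumnDoubled T i 1)
    (hg : Separates g i i') (ht : 0 < T (.horiz g 0)) : W.depot = .node i' 0 := by
  by_contra hd
  obtain ⟨h', hX'⟩ := h.shift hg hX ht one_ne_zero rfl
  have hpos := h'.horiz_pos hX' hd hg.symm
  rw [shift_horiz_left zero_ne_one, h.horiz_eq_one hX hg ht] at hpos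
  exact hpos.false

theorem horiz_eq_zero (h : W.IsExtremal T) (hX : ColumnDoubled T i 1) (hg : Separates g i i') :
    T (.horiz g 0) = 0 := by
  refine Nat.eq_zero_of_not_pos fun ht => ?_
  obtain ⟨g', i'', hg', hne, ht'⟩ := h.exists_horiz_ne hX hg ht
  have hnode := (h.depot_eq_of_horiz_pos hX hg' ht').symm.trans (h.depot_eq_of_horiz_pos hX hg ht)
  exact hg'.neighbor_ne hg hne (Vertex.node.inj hnode).1

theorem depot_eq (h : W.IsExtremal T) (hX : ColumnDoubled T i 1) : W.depot = .node i 0 := by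
  by_contra hd
  obtain ⟨g, i', hg, ht⟩ := h.exists_horiz hX hd
  exact ht.ne' (h.horiz_eq_zero hX hg)

/-- Otherwise the doubled stretch from the top of aisle `i` down would be a whole component. -/
theorem exists_columnDoubled_horiz_pos (h : W.IsExtremal T) (hX : ColumnDoubled T i 1)
    {v : W.Vertex} (hv : W.Required v) (hvi : W.aisleOf v ≠ i) :
    ∃ b g i', ColumnDoubled T i b ∧ Separates g i i' ∧ 0 < T (.horiz g b) := by
  by_contra! hcon
  have hnone (c g i') (hc : ColumnDoubled T i c) (hg : Separates g i i') : T (.horiz g c) = 0 :=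
    Nat.le_zero.1 (hcon c g i' hc hg)
  refine hvi ((h.1.1.conn_of_required hv).of_invariant
    (P := fun u => W.aisleOf u = i ∧ DoubledAbove T u) ?_ fun e a b he hj ha => ?_).1
  · rw [h.depot_eq hX]
    exact ⟨rfl, columnDoubled_zero T i⟩
  cases e with
  | horiz g c =>
    exfalso
    rcases hj with ⟨rfl, -⟩ | ⟨-, rfl⟩ <;> obtain ⟨rfl, ha⟩ := ha
    · exact he.ne' (hnone c g _ ha (.inl ⟨rfl, rfl⟩))
    · exact he.ne' (hnone c g _ ha (.inr ⟨rfl, rfl⟩))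
  | vert i' k j =>
    rcases hj with ⟨rfl, rfl⟩ | ⟨rfl, rfl⟩
    · rw [aisleOf_fst_vert] at ha
      obtain ⟨rfl, ha⟩ := ha
      exact ⟨aisleOf_snd_vert, doubledAbove_snd_vert_iff.2 ⟨ha, eq_two_of_doubledAbove
        h.1.1.boundary_eq_zero h.1.le_two hX hnone he ha⟩⟩
    · rw [aisleOf_snd_vert] at ha
      exact ⟨aisleOf_fst_vert.trans ha.1, (doubledAbove_snd_vert_iff.1 ha.2).1⟩

theorem not_columnDoubled_one (h : W.IsExtremal T) {v : W.Vertex} (hv : W.Required v)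
    (hvi : W.aisleOf v ≠ i) : ¬ ColumnDoubled T i 1 := by
  intro hX
  obtain ⟨b, g, i', hcol, hg, ht⟩ := h.exists_columnDoubled_horiz_pos hX hv hvi
  have hb : b ≠ 0 := by
    rintro rfl
    exact ht.ne' (h.horiz_eq_zero hX hg)
  obtain ⟨h', hX'⟩ := h.shift hg hcol ht hb Sym2.eq_swap
  have hzero := h'.horiz_eq_zero hX' hg.symm
  rw [shift_horiz_right hb] at hzero
  exact Nat.succ_ne_zero _ hzero

end IsExtremal

end Warehouse

namespace Layout

variable {m n m' n' : ℕ} {L : Layout m n} {L' : Layout m' n'}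

/-! ### Turning the warehouse upside down -/

/-- An isomorphism of warehouse graphs that preserves lengths. -/
structure Iso (L : Layout m n) (L' : Layout m' n') where
  vertex : L.Vertex ≃ L'.Vertex
  edge : L.Edge ≃ L'.Edge
  joins : ∀ {e u v}, e.Joins u v → (edge e).Joins (vertex u) (vertex v)
  length_edge : ∀ e, (edge e).length = e.length

/-- The inverse isomorphism. -/
def Iso.symm (φ : L.Iso L') : L'.Iso L where
  vertex := φ.vertex.symm
  edge := φ.edge.symm
  joins {e u v} h := by
    obtain ⟨e, rfl⟩ := φ.edge.surjective e
    have he := φ.joins e.joins_fst_snd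
    rw [Edge.joins_iff_mk_eq] at he h ⊢
    rw [he, ← Sym2.map_mk] at h
    rw [Equiv.symm_apply_apply, ← Sym2.map_mk, ← h, Sym2.map_map]
    simp
  length_edge e := by rw [← φ.length_edge, Equiv.apply_symm_apply]

/-- The image of a walk. -/
def Route.map (φ : L.Iso L') {u v : L.Vertex} : L.Route u v → L'.Route (φ.vertex u) (φ.vertex v)
  | nil v => nil (φ.vertex v)
  | cons e h p => cons (φ.edge e) (φ.joins h) (p.map φ)

theorem Route.edges_map (φ : L.Iso L') {u v : L.Vertex} (p : L.Route u v) :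
    (p.map φ).edges = p.edges.map φ.edge := by
  induction p with
  | nil v => rfl
  | cons e h p ih => rw [map, edges, edges, ih, List.map_cons]

theorem Route.support_map (φ : L.Iso L') {u v : L.Vertex} (p : L.Route u v) :
    (p.map φ).support = p.support.map φ.vertex := by
  induction p with
  | nil v => rfl
  | cons e h p ih => rw [map, support, support, ih, List.map_cons]

theorem totalLength_comp_edge (φ : L.Iso L') (T : L'.Edge → ℕ) :
    L.totalLength (T ∘ φ.edge) = L'.totalLength T := by
  rw [totalLength_eq_sum, totalLength_eq_sum, ← Equiv.sum_comp φ.edge]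
  simp only [Function.comp_apply, φ.length_edge]

/-- The layout turned upside down. -/
def flip (L : Layout m n) : Layout m n where
  spacing := L.spacing
  height k := L.height k.rev
  numPicks i k := L.numPicks i k.rev
  segLength i k j := L.segLength i k.rev j.rev
  spacing_pos := L.spacing_pos
  segLength_pos i k j := L.segLength_pos i k.rev j.rev
  sum_segLength i k :=
    (Equiv.sum_comp Fin.revPerm (L.segLength i k.rev)).trans (L.sum_segLength i k.rev)

/-- The vertex of `L` at a vertex of the layout turned upside down. -/
def flipVertex (L : Layout m n) : L.flip.Vertex ≃ L.Vertex :=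
  (L.flip.vertexEquiv.trans (.sumCongr (.prodCongr (.refl _) Fin.revPerm)
    (.sigmaCongrRight fun i => .sigmaCongr (β₂ := fun k => Fin (L.numPicks i k)) Fin.revPerm
      fun k => Fin.revPerm (n := L.numPicks i k.rev)))).trans L.vertexEquiv.symm

/-- The edge of `L` at an edge of the layout turned upside down. -/
def flipEdge (L : Layout m n) : L.flip.Edge ≃ L.Edge :=
  (L.flip.edgeEquiv.trans (.sumCongr (.prodCongr (.refl _) Fin.revPerm)
    (.sigmaCongrRight fun i => .sigmaCongr (β₂ := fun k => Fin (L.numPicks i k + 1)) Fin.revPerm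
      fun k => Fin.revPerm (n := L.numPicks i k.rev + 1)))).trans L.edgeEquiv.symm

theorem flipVertex_site (i : Fin (m + 1)) (k : Fin (n + 1)) (j : Fin (L.flip.numPicks i k + 2)) :
    L.flipVertex (L.flip.site i k j) =
      L.site i k.rev (Fin.rev (n := L.numPicks i k.rev + 2) j) := by
  cases j using Fin.cases with
  | zero =>
    change Vertex.node i k.castSucc.rev = L.site i k.rev (Fin.rev 0)
    rw [Fin.rev_zero, Fin.rev_castSucc]
    simp [site]
  | succ j =>
    cases j using Fin.lastCases with
    | last =>
      have h : L.flip.site i k (Fin.last _).succ = .node i k.succ := by simp [site]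
      rw [h]
      change Vertex.node i k.succ.rev = L.site i k.rev (Fin.rev (Fin.last _))
      rw [Fin.rev_last, Fin.rev_succ]
      rfl
    | cast j =>
      have h : L.flip.site i k j.castSucc.succ = .pick i k j := by simp [site]
      rw [h]
      change Fin (L.numPicks i k.rev) at j
      change Vertex.pick i k.rev j.rev = L.site i k.rev (Fin.rev j.castSucc.succ)
      rw [Fin.rev_succ, Fin.rev_castSucc, ← Fin.succ_castSucc]
      simp [site]

/-- Turning the layout upside down is an isomorphism. -/
def flipIso (L : Layout m n) : L.flip.Iso L where
  vertex := L.flipVertex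
  edge := L.flipEdge
  joins {e u v} h := by
    suffices he : (L.flipEdge e).Joins (L.flipVertex e.fst) (L.flipVertex e.snd) by
      rcases h with ⟨rfl, rfl⟩ | ⟨rfl, rfl⟩
      exacts [he, he.symm]
    cases e with
    | horiz g c => exact Or.inl ⟨rfl, rfl⟩
    | vert i k j =>
      refine Or.inr ⟨Eq.trans ?_ (flipVertex_site i k j.succ).symm,
        Eq.trans ?_ (flipVertex_site i k j.castSucc).symm⟩
      · exact congrArg (L.site i k.rev) (Fin.rev_succ j).symm
      · exact congrArg (L.site i k.rev) (Fin.rev_castSucc j).symm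
  length_edge e := by cases e <;> rfl

theorem forall_flipEdge_vert (T : L.Edge → ℕ) (i : Fin (m + 1)) (k : Fin (n + 1)) :
    (∀ j, T (L.flipEdge (.vert i k j)) = 2) ↔ ∀ j, T (.vert i k.rev j) = 2 :=
  ((Fin.revPerm (n := L.numPicks i k.rev + 1)).surjective.forall
    (p := fun j => T (.vert i k.rev j) = 2)).symm

theorem card_outerDoubled_flip (T : L.Edge → ℕ) :
    (outerDoubled (T ∘ L.flipEdge)).card = (outerDoubled T).card := by
  refine Finset.card_equiv (.prodCongr (.refl _) Fin.revPerm) fun ⟨i, k⟩ => ?_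
  rw [mem_outerDoubled, Equiv.prodCongr_apply, Prod.map_apply, mem_outerDoubled]
  refine and_congr ?_ (forall_flipEdge_vert T i k)
  simp only [Fin.revPerm_apply, Fin.rev_eq_iff, Fin.rev_zero, Fin.rev_last, or_comm]

end Layout

namespace Warehouse

open Layout

variable {m n m' n' : ℕ} {W : Warehouse m n} {W' : Warehouse m' n'}

/-- An isomorphism of layouts that preserves the locations to be visited and the depot. -/
structure Iso (W : Warehouse m n) (W' : Warehouse m' n')
    extends Layout.Iso W.toLayout W'.toLayout where
  vertex_depot : vertex W.depot = W'.depot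
  required : ∀ v, W'.Required (vertex v) ↔ W.Required v

/-- The inverse isomorphism. -/
def Iso.symm (φ : W.Iso W') : W'.Iso W where
  toIso := φ.toIso.symm
  vertex_depot := (Equiv.symm_apply_eq _).2 φ.vertex_depot.symm
  required v := by
    rw [← φ.required]
    exact iff_of_eq (congrArg _ (φ.vertex.apply_symm_apply v))

theorem IsTourSubgraph.comp_edge (φ : W.Iso W') {T : W'.Edge → ℕ} (hT : W'.IsTourSubgraph T) :
    W.IsTourSubgraph (T ∘ φ.edge) := by
  obtain ⟨p, hp, hcount⟩ := hT
  rw [IsTourSubgraph, ← φ.symm.vertex_depot]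
  refine ⟨p.map φ.symm.toIso, fun v hv => ?_, fun e => ?_⟩
  · rw [Route.support_map]
    exact List.mem_map.2 ⟨φ.vertex v, hp _ ((φ.required v).2 hv), φ.vertex.symm_apply_apply v⟩
  · rw [Route.edges_map, Function.comp_apply, hcount,
      ← List.count_map_of_injective _ _ φ.symm.edge.injective]
    exact congrArg (List.count · _) (φ.edge.symm_apply_apply e)

theorem IsMinTourSubgraph.comp_edge (φ : W.Iso W') {T : W'.Edge → ℕ}
    (hT : W'.IsMinTourSubgraph T) : W.IsMinTourSubgraph (T ∘ φ.edge) := by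
  refine ⟨hT.1.comp_edge φ, fun S hS => ?_⟩
  rw [totalLength_comp_edge, ← totalLength_comp_edge φ.symm.toIso S]
  exact hT.2 _ (hS.comp_edge φ.symm)

/-- The warehouse turned upside down. -/
def flip (W : Warehouse m n) : Warehouse m n where
  toLayout := W.toLayout.flip
  depot := W.flipVertex.symm W.depot

/-- Turning the warehouse upside down is an isomorphism. -/
def flipIso (W : Warehouse m n) : W.flip.Iso W where
  toIso := W.toLayout.flipIso
  vertex_depot := W.flipVertex.apply_symm_apply W.depot
  required v := by
    refine or_congr (Equiv.eq_symm_apply _).symm ?_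
    cases v with
    | node i c => exact iff_of_false (fun ⟨_, _, _, h⟩ => nomatch h) fun ⟨_, _, _, h⟩ => nomatch h
    | pick i k j => exact ⟨fun _ => ⟨_, _, _, rfl⟩, fun _ => ⟨_, _, _, rfl⟩⟩

theorem aisleOf_flipIso (v : W.flip.Vertex) :
    W.aisleOf (W.flipIso.vertex v) = W.flip.aisleOf v := by
  cases v <;> rfl

theorem IsExtremal.flip {T : W.Edge → ℕ} (h : W.IsExtremal T) :
    W.flip.IsExtremal (T ∘ W.flipEdge) := by
  refine ⟨h.1.comp_edge W.flipIso, fun S hS => ?_⟩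
  have hle := h.2 _ (hS.comp_edge W.flipIso.symm)
  rw [← card_outerDoubled_flip T, ← card_outerDoubled_flip (S ∘ _), Function.comp_assoc] at hle
  have hS' : S ∘ W.flipIso.symm.edge ∘ W.flipEdge = S :=
    funext fun e => congrArg S (W.flipEdge.symm_apply_apply e)
  rwa [hS'] at hle

theorem IsExtremal.not_forall_vert_last {T : W.Edge → ℕ} (h : W.IsExtremal T) {i : Fin (m + 1)}
    {v : W.Vertex} (hv : W.Required v) (hvi : W.aisleOf v ≠ i) :
    ¬ ∀ j, T (.vert i (Fin.last n) j) = 2 := by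
  obtain ⟨v, rfl⟩ := W.flipIso.vertex.surjective v
  rw [aisleOf_flipIso] at hvi
  intro hX
  refine h.flip.not_columnDoubled_one ((W.flipIso.required v).1 hv) hvi (columnDoubled_one.2 ?_)
  refine (forall_flipEdge_vert T i 0).2 ?_
  rwa [Fin.rev_zero]

theorem exists_isExtremal (W : Warehouse m n) : ∃ T, W.IsExtremal T := by
  obtain ⟨T, hT, hmin⟩ := exists_minimalFor_of_wellFoundedLT W.IsMinTourSubgraph
    (fun T => (outerDoubled T).card) W.exists_isMinTourSubgraph
  exact ⟨T, hT, fun S hS => (le_total _ _).elim id (hmin hS)⟩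

theorem exists_required_aisleOf_ne
    (hW : ∃ i i' : Fin (m + 1), i ≠ i' ∧ W.AisleNonempty i ∧ W.AisleNonempty i')
    (i : Fin (m + 1)) : ∃ v, W.Required v ∧ W.aisleOf v ≠ i := by
  obtain ⟨_, _, hne, ⟨u, hu, rfl⟩, ⟨v, hv, rfl⟩⟩ := hW
  rcases eq_or_ne (W.aisleOf u) i with rfl | hui
  · exact ⟨v, hv, hne.symm⟩
  · exact ⟨u, hu, hui⟩

end Warehouse

theorem mainTheorem1 {m n : ℕ} (W : Warehouse m n)
    (hW : ∃ i i' : Fin (m + 1), i ≠ i' ∧ W.AisleNonempty i ∧ W.AisleNonempty i') :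
    ∃ T : W.Edge → ℕ, W.IsMinTourSubgraph T ∧
      ∀ (i : Fin (m + 1)) (a b : Fin (n + 2)),
        W.IsDoubleEdge T i a b → ¬ Layout.IncludesOuter a b := by
  obtain ⟨T, hT⟩ := W.exists_isExtremal
  refine ⟨T, hT.1, fun i a b ⟨hab, hdouble, _⟩ hout => ?_⟩
  obtain ⟨v, hv, hvi⟩ := Warehouse.exists_required_aisleOf_ne hW i
  rcases hout with rfl | rfl
  · exact hT.not_columnDoubled_one hv hvi
      (Layout.columnDoubled_one.2 (hdouble 0 le_rfl (Fin.castSucc_lt_iff_succ_le.1 hab)))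
  · exact hT.not_forall_vert_last hv hvi
      (hdouble (Fin.last n) (Fin.le_castSucc_iff.2 hab) le_rfl)
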